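/- Let $p$ be an odd prime, $\overline{\mathbb Q}_p$ an algebraic closure of $\mathbb Q_p$ with the absolute value $|\cdot|_p$ extending that of $\mathbb Q_p$, and $K\subset\overline{\mathbb Q}_p$ a finite extension of $\mathbb Q_p$ with ring of integers $O_K$, maximal ideal $\mathfrak p_K$ and residue degree $f$ over $\mathbb Q_p$. For a generator $\pi$ of $\mathfrak p_K$ let $R_\pi$ be the ring of integers of $\mathbb Q_p(\pi)$. A *$\pi$-unramified group law* is a one-dimensional commutative formal group law $\mathfrak F$ over $O_K$ together with a formal $R_\pi$-module structure, i.e. a ring homomorphism $a\mapsto[a](X)=aX+\cdots$ from $R_\pi$ to $\mathrm{End}_{O_K}(\mathfrak F)$. It has *height* $h$, where $h$ is a positive integer, if, writing $[\pi](X)=\pi X+a_2X^2+a_3X^3+\cdots$, the least $i\ge2$ with $|a_i|_p=1$ exists and equals $p^h$. Let $\mathfrak F[\pi]=\{x\in\overline{\mathbb Q}_p : |x|_p<1,\ [\pi](x)=0\}$. **Theorem 1.1.** Let $n\ge2$, let $\pi_1,\dots,\pi_n$ be generators of $\mathfrak p_K$, and for each $i$ let $\mathfrak F_i$ be a $\pi_i$-unramified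 group law over $O_K$, all of the same height $h$. Assume $h\mid f$. Put $q=p^h$ and $K_1=K(\mu_{(q-1)(p^f-1)})$, where $\mu_m$ is the group of $m$-th roots of unity in $\overline{\mathbb Q}_p$. Then $$K_1(\mathfrak F_1[\pi_1])=\cdots=K_1(\mathfrak F_n[\pi_n])=K_1(\mathfrak F_1[\pi_1],\dots,\mathfrak F_n[\pi_n]).$$ -/

import Mathlib

open scoped IntermediateField

namespace FormalDivision

noncomputable section

/-! ### Subfields of the algebraic closure of `ℚ_p` -/

section Fields

variable {p : ℕ} [Fact p.Prime]

/-- The ring of integers `O_L = {x ∈ L : |x|_p ≤ 1}` of a subfield `L` of the algebraic closure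
of `ℚ_p`, as the valuation ring of the restriction to `L` of the `p`-adic absolute value. -/
def ringOfIntegers (L : IntermediateField ℚ_[p] (PadicAlgCl p)) : ValuationSubring L :=
  ((NormedField.valuation (K := PadicAlgCl p)).comap
    (algebraMap L (PadicAlgCl p))).valuationSubring

theorem mem_ringOfIntegers {L : IntermediateField ℚ_[p] (PadicAlgCl p)} (x : L) :
    x ∈ ringOfIntegers L ↔ ‖(x : PadicAlgCl p)‖ ≤ 1 :=
  Iff.rfl

/-- The inclusion `O_E → O_L` for subfields `E ⊆ L` of the algebraic closure of `ℚ_p`. -/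
def integersInclusion {E L : IntermediateField ℚ_[p] (PadicAlgCl p)} (h : E ≤ L) :
    ringOfIntegers E →+* ringOfIntegers L where
  toFun x := ⟨IntermediateField.inclusion h x.1, x.2⟩
  map_one' := rfl
  map_mul' _ _ := rfl
  map_zero' := rfl
  map_add' _ _ := rfl

/-- The structure map `ℤ_p → O_L`. -/
def padicIntMap (L : IntermediateField ℚ_[p] (PadicAlgCl p)) : ℤ_[p] →+* ringOfIntegers L :=
  ((algebraMap ℚ_[p] L).comp PadicInt.Coe.ringHom).codRestrict (ringOfIntegers L).toSubring
    fun x => (mem_ringOfIntegers _).2 ((PadicAlgCl.norm_extends p (x : ℚ_[p])).trans_le x.2)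

instance (L : IntermediateField ℚ_[p] (PadicAlgCl p)) : Algebra ℤ_[p] (ringOfIntegers L) :=
  (padicIntMap L).toAlgebra

theorem norm_algebraMap_padicInt (L : IntermediateField ℚ_[p] (PadicAlgCl p)) (x : ℤ_[p]) :
    ‖(((algebraMap ℤ_[p] (ringOfIntegers L) x : ringOfIntegers L) : L) : PadicAlgCl p)‖ = ‖x‖ :=
  PadicAlgCl.norm_extends p (x : ℚ_[p])

instance (L : IntermediateField ℚ_[p] (PadicAlgCl p)) :
    IsLocalHom (algebraMap ℤ_[p] (ringOfIntegers L)) where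
  map_nonunit x hx := by
    obtain ⟨y, hy⟩ := hx.exists_right_inv
    rw [PadicInt.isUnit_iff]
    refine le_antisymm x.2 ?_
    have h := congrArg (fun z : ringOfIntegers L => ‖((z : L) : PadicAlgCl p)‖) hy
    have hy' : ‖((y : L) : PadicAlgCl p)‖ ≤ 1 := y.2
    simp only [MulMemClass.coe_mul, norm_mul, norm_algebraMap_padicInt, OneMemClass.coe_one,
      norm_one] at h
    nlinarith [norm_nonneg x]

/-- The residue degree of `L` over `ℚ_p`: the degree of the residue field of `O_L` over the residue
field of `ℤ_p`. -/
def residueDegree (L : IntermediateField ℚ_[p] (PadicAlgCl p)) : ℕ :=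
  Module.finrank (IsLocalRing.ResidueField ℤ_[p]) (IsLocalRing.ResidueField (ringOfIntegers L))

/-- `L(μ_m)`, the field generated over `L` by all `m`-th roots of unity in the algebraic
closure. -/
def adjoinRootsOfUnity (L : IntermediateField ℚ_[p] (PadicAlgCl p)) (m : ℕ) :
    IntermediateField ℚ_[p] (PadicAlgCl p) :=
  (IntermediateField.adjoin L {ζ : PadicAlgCl p | ζ ^ m = 1}).restrictScalars ℚ_[p]

/-- The subfield `ℚ_p(π)`, for `π ∈ O_K`. -/
abbrev generatedField {K : IntermediateField ℚ_[p] (PadicAlgCl p)} (π : ringOfIntegers K) :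
    IntermediateField ℚ_[p] (PadicAlgCl p) :=
  ℚ_[p]⟮((π : K) : PadicAlgCl p)⟯

theorem generatedField_le {K : IntermediateField ℚ_[p] (PadicAlgCl p)} (π : ringOfIntegers K) :
    generatedField π ≤ K :=
  IntermediateField.adjoin_simple_le_iff.2 (π : K).2

/-- The element `π` regarded as an element of the ring of integers of `ℚ_p(π)`. -/
def generatedField.gen {K : IntermediateField ℚ_[p] (PadicAlgCl p)} (π : ringOfIntegers K) :
    ringOfIntegers (generatedField π) :=
  ⟨⟨((π : K) : PadicAlgCl p), IntermediateField.mem_adjoin_simple_self _ _⟩, π.2⟩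

end Fields

/-! ### Formal modules -/

/-- A (one-dimensional, commutative) formal `A`-module over `S`, for a ring homomorphism
`ι : A → S`: a commutative formal group law `F` over `S` with a ring homomorphism
`a ↦ [a](X)` from `A` to the endomorphism ring of `F` such that `[a](X) = ι(a) X + ⋯`. -/
structure FormalModule {A S : Type*} [CommRing A] [CommRing S] (ι : A →+* S) where
  /-- The underlying formal group law. -/
  law : FormalGroup S
  /-- `F(X, Y) = F(Y, X)`. -/
  isComm : law.IsComm
  /-- The power series `[a](X)`. -/
  bracket : A → PowerSeries S
  constantCoeff_bracket : ∀ a, PowerSeries.constantCoeff (bracket a) = 0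
  coeff_one_bracket : ∀ a, PowerSeries.coeff 1 (bracket a) = ι a
  /-- `[a](F(X, Y)) = F([a](X), [a](Y))`. -/
  bracket_law : ∀ a,
    PowerSeries.subst law.toPowerSeries (bracket a) =
      law.toPowerSeries.subst
        ![PowerSeries.subst (MvPowerSeries.X 0 : MvPowerSeries (Fin 2) S) (bracket a),
          PowerSeries.subst (MvPowerSeries.X 1 : MvPowerSeries (Fin 2) S) (bracket a)]
  /-- `[a + b](X) = F([a](X), [b](X))`. -/
  bracket_add : ∀ a b, bracket (a + b) = law.toPowerSeries.subst ![bracket a, bracket b]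
  /-- `[1](X) = X`. -/
  bracket_one : bracket 1 = PowerSeries.X
  /-- `[ab](X) = [a]([b](X))`. -/
  bracket_mul : ∀ a b, bracket (a * b) = PowerSeries.subst (bracket b) (bracket a)

section Unramified

variable {p : ℕ} [Fact p.Prime] {K : IntermediateField ℚ_[p] (PadicAlgCl p)}

/-- A `π`-unramified group law over `O_K`: a one-dimensional commutative formal group law over
`O_K` with a formal `R`-module structure, where `R` is the ring of integers of `ℚ_p(π)`. -/
abbrev UnramifiedGroupLaw (π : ringOfIntegers K) :=
  FormalModule (integersInclusion (generatedField_le π))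

namespace UnramifiedGroupLaw

variable {π : ringOfIntegers K}

/-- The `i`-th coefficient of `[π](X)`, in the algebraic closure of `ℚ_p`. -/
def piCoeff (F : UnramifiedGroupLaw π) (i : ℕ) : PadicAlgCl p :=
  ((PowerSeries.coeff i (F.bracket (generatedField.gen π)) : ringOfIntegers K) : K)

/-- `F` has height `h`: `h` is a positive integer, and for `[π](X) = π X + a₂ X² + a₃ X³ + ⋯` the
least `i ≥ 2` with `|a_i|_p = 1` exists and is `p ^ h`. -/
def HasHeight (F : UnramifiedGroupLaw π) (h : ℕ) : Prop :=
  0 < h ∧ IsLeast {i : ℕ | 2 ≤ i ∧ ‖piCoeff F i‖ = 1} (p ^ h)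

/-- `F[π]`, the `π`-torsion of the `R`-module that `F` defines on the maximal ideal
`{x : |x|_p < 1}` of the integers of the algebraic closure of `ℚ_p`: the points `x` at which the
sum of the (convergent) series `[π](x)` is `0`. -/
def piTorsion (F : UnramifiedGroupLaw π) : Set (PadicAlgCl p) :=
  {x | ‖x‖ < 1 ∧ HasSum (fun i : ℕ => piCoeff F i * x ^ i) 0}

end UnramifiedGroupLaw

end Unramified

end

end FormalDivision

/-! ### Power series close to `X - X ^ q` over ultrametric fields -/

namespace IsUltrametricDist

open Filter Topology

section Group

variable {G ι : Type*} [SeminormedAddCommGroup G] [IsUltrametricDist G]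

/-! Only the coefficients of `[π](X)` matter: the series is of Eisenstein type, with linear
coefficient `π`, coefficients divisible by `π` below index `q`, and a unit `a_q` at index `q`.
Choose `t` with `t ^ (q - 1) = -π / a_q`. Substituting `X = tZ` and dividing by `πt` gives a series
close to `Z - Z ^ q` (`IsEisensteinSeries.isNearXSubXPow`), and the nonzero torsion points
correspond to its zeros of norm `1`. Near each `(q - 1)`-th root of unity there is exactly one such
zero, found by a contraction inside any complete subfield containing that root of unity and the
coefficients. Hence `L(F[π]) = L(t)` for every finite extension `L` of `K` containing `μ_{q-1}`
(`adjoin_piTorsion_eq`).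

For two group laws with parameters `t` and `t'`, the power `(t / t') ^ (q - 1)` is a unit of `K`.
Its `(p ^ f - 1)`-th power is close to `1`, so it has a root of exponent `(q - 1)(p ^ f - 1)` in
`K`. Thus `t / t'` is a root of unity times an element of `K` and lies in `K₁`, which gives `K₁(t) =
K₁(t')`. -/

theorem norm_sub_le_max_norm (x y : G) : ‖x - y‖ ≤ max ‖x‖ ‖y‖ := by
  rw [sub_eq_add_neg, ← norm_neg y]
  exact norm_add_le_max _ _

theorem norm_le_of_hasSum {f : ι → G} {a : G} (h : HasSum f a) {C : ℝ} (hC : 0 ≤ C)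
    (hf : ∀ i, ‖f i‖ ≤ C) : ‖a‖ ≤ C :=
  le_of_tendsto h.norm (Eventually.of_forall fun _ =>
    norm_sum_le_of_forall_le_of_nonneg hC fun i _ => hf i)

end Group

variable {E : Type*} [NormedField E]

section Pow

variable [IsUltrametricDist E]

theorem norm_pow_sub_pow_le {z w : E} (hz : ‖z‖ ≤ 1) (hw : ‖w‖ ≤ 1) (n : ℕ) :
    ‖z ^ n - w ^ n‖ ≤ ‖z - w‖ := by
  rw [← (Commute.all z w).geom_sum₂_mul n, norm_mul]
  refine mul_le_of_le_one_left (norm_nonneg _) ?_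
  refine norm_sum_le_of_forall_le_of_nonneg zero_le_one fun i _ => ?_
  rw [norm_mul, norm_pow, norm_pow]
  exact mul_le_one₀ (pow_le_one₀ (norm_nonneg _) hz) (by positivity)
    (pow_le_one₀ (norm_nonneg _) hw)

theorem norm_pow_sub_pow_le_mul {z w : E} (hz : ‖z‖ ≤ 1) (hw : ‖w‖ ≤ 1) {n : ℕ} {r : ℝ}
    (hn : ‖(n : E)‖ ≤ r) (hr : ‖z - w‖ ≤ r) : ‖z ^ n - w ^ n‖ ≤ r * ‖z - w‖ := by
  have hr0 : 0 ≤ r := (norm_nonneg _).trans hr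
  rw [← (Commute.all z w).geom_sum₂_mul n, norm_mul]
  refine mul_le_mul_of_nonneg_right ?_ (norm_nonneg _)
  -- The cofactor of `z - w` is congruent to the derivative `n * w ^ (n - 1)` modulo `z - w`, and
  -- both have norm at most `r`.
  have key : ∑ i ∈ Finset.range n, z ^ i * w ^ (n - 1 - i) =
      ∑ i ∈ Finset.range n, (z ^ i - w ^ i) * w ^ (n - 1 - i) + n * w ^ (n - 1) := by
    have hc : (n : E) * w ^ (n - 1) = ∑ _i ∈ Finset.range n, w ^ (n - 1) := by simp
    rw [hc, ← Finset.sum_add_distrib]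
    refine Finset.sum_congr rfl fun i hi => ?_
    rw [sub_mul, ← pow_add,
      Nat.add_sub_cancel' (Nat.le_sub_one_of_lt (Finset.mem_range.1 hi)), sub_add_cancel]
  rw [key]
  refine (norm_add_le_max _ _).trans (max_le ?_ ?_)
  · refine norm_sum_le_of_forall_le_of_nonneg hr0 fun i _ => ?_
    rw [norm_mul, norm_pow]
    exact (mul_le_of_le_one_right (norm_nonneg _) (pow_le_one₀ (norm_nonneg _) hw)).trans
      ((norm_pow_sub_pow_le hz hw i).trans hr)
  · rw [norm_mul, norm_pow]
    exact (mul_le_of_le_one_right (norm_nonneg _) (pow_le_one₀ (norm_nonneg _) hw)).trans hn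

end Pow

/-- The power series `∑ b i X ^ i` agrees with `X - X ^ q` up to coefficients of norm at most
`r < 1`, where also `‖q‖ ≤ r`. -/
structure IsNearXSubXPow (b : ℕ → E) (q : ℕ) (r : ℝ) : Prop where
  lt_one : r < 1
  two_le : 2 ≤ q
  norm_natCast_le : ‖(q : E)‖ ≤ r
  one : b 1 = 1
  norm_add_one_le : ‖b q + 1‖ ≤ r
  norm_le : ∀ i, i ≠ 1 → i ≠ q → ‖b i‖ ≤ r

namespace IsNearXSubXPow

variable {b : ℕ → E} {q : ℕ} {r : ℝ}

theorem nonneg (h : IsNearXSubXPow b q r) : 0 ≤ r :=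
  (norm_nonneg _).trans h.norm_natCast_le

theorem mono (h : IsNearXSubXPow b q r) {s : ℝ} (hrs : r ≤ s) (hs : s < 1) :
    IsNearXSubXPow b q s :=
  ⟨hs, h.two_le, h.norm_natCast_le.trans hrs, h.one, h.norm_add_one_le.trans hrs,
    fun i hi hi' => (h.norm_le i hi hi').trans hrs⟩

variable [IsUltrametricDist E]

theorem norm_coeff_le_one (h : IsNearXSubXPow b q r) (i : ℕ) : ‖b i‖ ≤ 1 := by
  by_cases hi : i = 1
  · simp [hi, h.one]
  by_cases hq : i = q
  · rw [hq, ← add_sub_cancel_right (b q) 1]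
    exact (norm_sub_le_max_norm _ _).trans
      (max_le (h.norm_add_one_le.trans h.lt_one.le) norm_one.le)
  · exact (h.norm_le i hi hq).trans h.lt_one.le

/-- Termwise contraction for `X` minus the series. The coefficient at `q` is not small, but there
the derivative of `X ^ q` supplies the factor `‖q‖ ≤ r`. -/
theorem norm_mul_pow_sub_pow_le (h : IsNearXSubXPow b q r) {z w : E} (hz : ‖z‖ ≤ 1)
    (hw : ‖w‖ ≤ 1) (hzw : ‖z - w‖ ≤ r) (i : ℕ) :
    ‖(if i = 1 then 0 else -b i) * (z ^ i - w ^ i)‖ ≤ r * ‖z - w‖ := by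
  split_ifs with hi
  · simpa using mul_nonneg h.nonneg (norm_nonneg _)
  rw [norm_mul, norm_neg]
  by_cases hq : i = q
  · subst hq
    exact (mul_le_of_le_one_left (norm_nonneg _) (h.norm_coeff_le_one i)).trans
      (norm_pow_sub_pow_le_mul hz hw h.norm_natCast_le hzw)
  · exact mul_le_mul (h.norm_le i hi hq) (norm_pow_sub_pow_le hz hw i) (norm_nonneg _) h.nonneg

theorem norm_sub_pow_le (h : IsNearXSubXPow b q r) {z a : E} (hz : ‖z‖ ≤ 1)
    (ha : HasSum (fun i => (if i = 1 then 0 else -b i) * z ^ i) a) : ‖a - z ^ q‖ ≤ r := by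
  refine norm_le_of_hasSum (ha.sub (hasSum_ite_eq q (z ^ q))) h.nonneg fun i => ?_
  have hzi : ‖z ^ i‖ ≤ 1 := by
    rw [norm_pow]
    exact pow_le_one₀ (norm_nonneg _) hz
  by_cases hq : i = q
  · subst hq
    have hi : i ≠ 1 := by have := h.two_le; omega
    simp only [hi, if_false, if_true]
    rw [show -b i * z ^ i - z ^ i = -((b i + 1) * z ^ i) by ring, norm_neg, norm_mul]
    exact (mul_le_of_le_one_right (norm_nonneg _) hzi).trans h.norm_add_one_le
  · simp only [hq, if_false, sub_zero]
    split_ifs with hi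
    · simpa using h.nonneg
    · rw [norm_mul, norm_neg]
      exact (mul_le_of_le_one_right (norm_nonneg _) hzi).trans (h.norm_le i hi hq)

/-- Turns zeros of the series into fixed points of `X` minus the series. -/
theorem hasSum_iff (h : IsNearXSubXPow b q r) (z a : E) :
    HasSum (fun i => (if i = 1 then 0 else -b i) * z ^ i) a ↔
      HasSum (fun i => b i * z ^ i) (z - a) := by
  have e : ∀ i, (if i = 1 then 0 else -b i) * z ^ i =
      (if i = 1 then z else 0) - b i * z ^ i := by
    intro i
    split_ifs with hi
    · simp [hi, h.one]
    · ring
  constructor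
  · intro ha
    have := (hasSum_ite_eq 1 z).sub ha
    simpa [e] using this
  · intro ha
    have := (hasSum_ite_eq 1 z).sub ha
    simpa [e] using this

theorem eq_of_hasSum (h : IsNearXSubXPow b q r) {z w : E} (hz : ‖z‖ ≤ 1) (hw : ‖w‖ ≤ 1)
    (hzw : ‖z - w‖ ≤ r) (hz0 : HasSum (fun i => b i * z ^ i) 0)
    (hw0 : HasSum (fun i => b i * w ^ i) 0) : z = w := by
  have h1 := (h.hasSum_iff z z).2 (by simpa using hz0)
  have h2 := (h.hasSum_iff w w).2 (by simpa using hw0)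
  have h3 := h1.sub h2
  simp only [← mul_sub] at h3
  have h4 := norm_le_of_hasSum h3 (mul_nonneg h.nonneg (norm_nonneg _))
    (h.norm_mul_pow_sub_pow_le hz hw hzw)
  have h5 := h.lt_one
  have h6 : ‖z - w‖ = 0 := by nlinarith [norm_nonneg (z - w)]
  exact sub_eq_zero.1 (norm_eq_zero.1 h6)

theorem norm_pow_sub_one_le (h : IsNearXSubXPow b q r) {z : E} (hz : ‖z‖ = 1)
    (hz0 : HasSum (fun i => b i * z ^ i) 0) : ‖z ^ (q - 1) - 1‖ ≤ r := by
  have h1 := h.norm_sub_pow_le hz.le ((h.hasSum_iff z z).2 (by simpa using hz0))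
  have h2 := h.two_le
  rwa [← norm_neg, neg_sub, show z ^ q - z = z * (z ^ (q - 1) - 1) by
    rw [mul_sub, ← pow_succ', Nat.sub_add_cancel (by omega), mul_one], norm_mul, hz,
    one_mul] at h1

/-- Banach's fixed point theorem on the points of `M` within `r` of `ζ`. Completeness is asked of
`M` only, so that the ambient field may be an algebraic closure of `ℚ_p`. -/
theorem exists_hasSum_zero (h : IsNearXSubXPow b q r) {M : Subfield E}
    (hM : IsComplete (M : Set E)) (hbM : ∀ i, b i ∈ M) (hb : Summable fun i => ‖b i‖)
    {ζ : E} (hζM : ζ ∈ M) (hζ : ζ ^ (q - 1) = 1) :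
    ∃ z ∈ M, ‖z - ζ‖ ≤ r ∧ HasSum (fun i => b i * z ^ i) 0 := by
  have hq := h.two_le
  have hζ1 : ‖ζ‖ = 1 := by
    rw [← pow_eq_one_iff_of_nonneg (norm_nonneg _) (show q - 1 ≠ 0 by omega), ← norm_pow, hζ,
      norm_one]
  have hζq : ζ ^ q = ζ := by
    rw [← Nat.sub_add_cancel (show 1 ≤ q by omega), pow_succ, hζ, one_mul]
  set c : ℕ → E := fun i => if i = 1 then 0 else -b i with hc
  set φ : E → E := fun z => ∑' i, c i * z ^ i with hφ
  have hcM : ∀ i, c i ∈ M := fun i => by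
    simp only [hc]
    split_ifs
    exacts [M.zero_mem, M.neg_mem (hbM i)]
  have hsum : ∀ z ∈ M, ‖z‖ ≤ 1 → HasSum (fun i => c i * z ^ i) (φ z) ∧ φ z ∈ M := by
    intro z hz hz1
    have : CompleteSpace M := hM.completeSpace_coe
    have hS : Summable fun i => (⟨c i * z ^ i, M.mul_mem (hcM i) (M.pow_mem hz i)⟩ : M) := by
      refine Summable.of_norm (hb.of_nonneg_of_le (fun _ => norm_nonneg _) fun i => ?_)
      change ‖c i * z ^ i‖ ≤ _
      rw [norm_mul, norm_pow]
      refine (mul_le_of_le_one_right (norm_nonneg _) (pow_le_one₀ (norm_nonneg _) hz1)).trans ?_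
      simp only [hc]
      split_ifs
      · simp
      · rw [norm_neg]
    have hS' := hS.hasSum.map M.subtype.toAddMonoidHom continuous_subtype_val
    have hS2 : HasSum (fun i => c i * z ^ i) ((∑' i, (⟨c i * z ^ i,
        M.mul_mem (hcM i) (M.pow_mem hz i)⟩ : M) : M) : E) := hS'
    refine ⟨hS2.summable.hasSum, ?_⟩
    simp only [hφ]
    rw [hS2.tsum_eq]
    exact Subtype.property _
  let s : Set E := (M : Set E) ∩ Metric.closedBall ζ r
  have hs : IsComplete s := by
    intro f hf hfs
    obtain ⟨x, hxM, hfx⟩ := hM f hf (hfs.trans (Filter.principal_mono.2 Set.inter_subset_left))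
    have := hf.1
    refine ⟨x, ⟨hxM, Metric.isClosed_closedBall.mem_of_tendsto (f := id) hfx ?_⟩, hfx⟩
    exact Filter.le_principal_iff.1 (hfs.trans (Filter.principal_mono.2 Set.inter_subset_right))
  have hs1 : ∀ z ∈ s, z ∈ M ∧ ‖z - ζ‖ ≤ r ∧ ‖z‖ ≤ 1 := by
    intro z hz
    have hd : ‖z - ζ‖ ≤ r := mem_closedBall_iff_norm.1 hz.2
    refine ⟨hz.1, hd, ?_⟩
    rw [← sub_add_cancel z ζ]
    exact (norm_add_le_max _ _).trans (max_le (hd.trans h.lt_one.le) hζ1.le)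
  have hlip : ∀ z ∈ s, ∀ w ∈ s, ‖φ z - φ w‖ ≤ r * ‖z - w‖ := by
    intro z hz w hw
    obtain ⟨hzM, hzr, hz1⟩ := hs1 z hz
    obtain ⟨hwM, hwr, hw1⟩ := hs1 w hw
    have h3 := (hsum z hzM hz1).1.sub (hsum w hwM hw1).1
    simp only [← mul_sub] at h3
    refine norm_le_of_hasSum h3 (mul_nonneg h.nonneg (norm_nonneg _))
      (h.norm_mul_pow_sub_pow_le hz1 hw1 ?_)
    rw [← sub_sub_sub_cancel_right z w ζ]
    exact (norm_sub_le_max_norm _ _).trans (max_le hzr hwr)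
  have hζs : ζ ∈ s := ⟨hζM, Metric.mem_closedBall_self h.nonneg⟩
  have hφζ : ‖φ ζ - ζ‖ ≤ r := by
    have := h.norm_sub_pow_le hζ1.le (hsum ζ hζM hζ1.le).1
    rwa [hζq] at this
  have hmaps : Set.MapsTo φ s s := by
    intro z hz
    obtain ⟨hzM, hzr, hz1⟩ := hs1 z hz
    refine ⟨(hsum z hzM hz1).2, mem_closedBall_iff_norm.2 ?_⟩
    rw [← sub_add_sub_cancel (φ z) (φ ζ) ζ]
    refine (norm_add_le_max _ _).trans (max_le ((hlip z hz ζ hζs).trans ?_) hφζ)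
    exact mul_le_of_le_one_right h.nonneg (hzr.trans h.lt_one.le)
  have hcontr : ContractingWith ⟨r, h.nonneg⟩ (hmaps.restrict φ s s) := by
    refine ⟨by exact_mod_cast h.lt_one, LipschitzWith.of_dist_le_mul fun z w => ?_⟩
    change dist (φ z) (φ w) ≤ r * dist (z : E) w
    rw [dist_eq_norm, dist_eq_norm]
    exact hlip z z.2 w w.2
  obtain ⟨z, hzs, hfix, -⟩ := hcontr.exists_fixedPoint' hs hmaps hζs (edist_ne_top _ _)
  obtain ⟨hzM, hzr, hz1⟩ := hs1 z hzs
  refine ⟨z, hzM, hzr, ?_⟩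
  have := (h.hasSum_iff z (φ z)).1 (hsum z hzM hz1).1
  rwa [hfix.eq, sub_self] at this

/-- The zero `z` is close to some root of unity `ζ`; uniqueness identifies it with the zero that the
contraction produces in `M` near `ζ`. -/
theorem mem_of_hasSum_zero [IsAlgClosed E] (h : IsNearXSubXPow b q r) {M : Subfield E}
    (hM : IsComplete (M : Set E)) (hbM : ∀ i, b i ∈ M) (hb : Summable fun i => ‖b i‖)
    (hμ : ∀ ζ : E, ζ ^ (q - 1) = 1 → ζ ∈ M) {z : E} (hz : ‖z‖ = 1)
    (hz0 : HasSum (fun i => b i * z ^ i) 0) : z ∈ M := by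
  have hq := h.two_le
  obtain ⟨ζ, hζ, hζz⟩ : ∃ ζ : E, ζ ^ (q - 1) = 1 ∧ ‖z - ζ‖ < 1 := by
    -- Otherwise every factor of `z ^ (q - 1) - 1 = ∏ (z - ζ)` has norm at least `1`.
    by_contra! H
    have hlt := (h.norm_pow_sub_one_le hz hz0).trans_lt h.lt_one
    have hmon : (Polynomial.X ^ (q - 1) - 1 : Polynomial E).Monic :=
      Polynomial.monic_X_pow_sub_C 1 (by omega)
    have hev := Polynomial.Splits.eval_eq_prod_roots_of_monic
      (IsAlgClosed.splits (Polynomial.X ^ (q - 1) - 1 : Polynomial E)) hmon z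
    simp only [Polynomial.eval_sub, Polynomial.eval_pow, Polynomial.eval_X,
      Polynomial.eval_one] at hev
    rw [hev] at hlt
    refine hlt.not_ge ?_
    have hp : ∀ s : Multiset E, (∀ x ∈ s, 1 ≤ ‖z - x‖) → 1 ≤ ‖(s.map (z - ·)).prod‖ := by
      intro s
      induction s using Multiset.induction with
      | empty => simp
      | cons a s ih =>
        intro hs
        rw [Multiset.map_cons, Multiset.prod_cons, norm_mul]
        exact one_le_mul_of_one_le_of_one_le (hs a (Multiset.mem_cons_self a s))
          (ih fun x hx => hs x (Multiset.mem_cons_of_mem hx))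
    refine hp _ fun x hx => H x ?_
    have hx := (Polynomial.mem_roots hmon.ne_zero).1 hx
    simpa [sub_eq_zero] using hx
  obtain ⟨w, hwM, hw, hw0⟩ := h.exists_hasSum_zero hM hbM hb (hμ ζ hζ) hζ
  have hζ1 : ‖ζ‖ = 1 := by
    rw [← pow_eq_one_iff_of_nonneg (norm_nonneg _) (show q - 1 ≠ 0 by omega), ← norm_pow, hζ,
      norm_one]
  have hw1 : ‖w‖ ≤ 1 := by
    rw [← sub_add_cancel w ζ]
    exact (norm_add_le_max _ _).trans (max_le (hw.trans h.lt_one.le) hζ1.le)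
  -- The distance from `z` to `ζ` may exceed `r`, so the radius of uniqueness is enlarged, still
  -- below `1`.
  have h' := h.mono (le_max_left r ‖z - ζ‖) (max_lt h.lt_one hζz)
  rw [h'.eq_of_hasSum hz.le hw1 ?_ hz0 hw0]
  · exact hwM
  · rw [← sub_sub_sub_cancel_right z w ζ, max_comm]
    exact (norm_sub_le_max_norm _ _).trans (max_le_max le_rfl hw)

end IsNearXSubXPow

variable [IsUltrametricDist E]

/-- Elements close to `1` have `(q - 1)`-th roots close to `1` in a complete field, if `‖q‖ < 1`. -/
theorem exists_pow_eq_of_norm_sub_one_lt {M : Subfield E} (hM : IsComplete (M : Set E)) {q : ℕ}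
    (hq : 2 ≤ q) (hq1 : ‖(q : E)‖ < 1) {c : E} (hc : c ∈ M) (hc1 : ‖c - 1‖ < 1) :
    ∃ y ∈ M, ‖y - 1‖ < 1 ∧ y ^ (q - 1) = c := by
  have hcn : ‖c‖ = 1 := by
    have := norm_add_eq_max_of_norm_ne_norm (x := c - 1) (y := 1) (by rw [norm_one]; exact hc1.ne)
    rwa [sub_add_cancel, norm_one, max_eq_right hc1.le] at this
  have hc0 : c ≠ 0 := by
    rintro rfl
    simp at hcn
  -- The nonzero zeros of `X - c⁻¹ X ^ q` are the `(q - 1)`-th roots of `c`.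
  let b : ℕ → E := fun i => if i = 1 then 1 else if i = q then -c⁻¹ else 0
  have hbi : ∀ i ∉ ({1, q} : Finset ℕ), b i = 0 := by
    intro i hi
    simp only [Finset.mem_insert, Finset.mem_singleton, not_or] at hi
    simp [b, hi.1, hi.2]
  have hbq : b q = -c⁻¹ := by simp [b, show q ≠ 1 by omega]
  have h : IsNearXSubXPow b q (max ‖c - 1‖ ‖(q : E)‖) := by
    refine ⟨max_lt hc1 hq1, hq, le_max_right _ _, by simp [b], ?_, fun i h1 h2 => ?_⟩
    · rw [hbq, show -c⁻¹ + 1 = c⁻¹ * (c - 1) by field_simp; ring, norm_mul, norm_inv, hcn,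
        inv_one, one_mul]
      exact le_max_left _ _
    · simp [b, h1, h2]
  obtain ⟨y, hyM, hy, hy0⟩ := h.exists_hasSum_zero hM (fun i => by
      simp only [b]
      split_ifs
      exacts [M.one_mem, M.neg_mem (M.inv_mem hc), M.zero_mem])
    (summable_of_ne_finset_zero (s := {1, q}) fun i hi => by rw [hbi i hi, norm_zero])
    M.one_mem (one_pow _)
  have hy1 : ‖y - 1‖ < 1 := hy.trans_lt (max_lt hc1 hq1)
  refine ⟨y, hyM, hy1, ?_⟩
  have hyne : y ≠ 0 := by
    rintro rfl
    simp at hy1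
  have h0 := hy0.unique (hasSum_sum_of_ne_finset_zero (s := {1, q}) fun i hi => by
    rw [hbi i hi, zero_mul])
  rw [Finset.sum_pair (by omega), hbq] at h0
  have h1 : y * (y ^ (q - 1) - c) = 0 := by
    rw [mul_sub, ← pow_succ', Nat.sub_add_cancel (by omega)]
    simp only [b, if_true] at h0
    field_simp at h0
    linear_combination h0
  exact sub_eq_zero.1 ((mul_eq_zero.1 h1).resolve_left hyne)

theorem exists_div_pow_eq_one {M : Subfield E} (hM : IsComplete (M : Set E)) {q r : ℕ}
    (hq : 2 ≤ q) (hq1 : ‖(q : E)‖ < 1) (hr : 2 ≤ r) (hr1 : ‖(r : E)‖ < 1) {v : E} (hv : v ≠ 0)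
    (hvM : v ^ (q - 1) ∈ M) (hv1 : ‖(v ^ (q - 1)) ^ (r - 1) - 1‖ < 1) :
    ∃ w ∈ M, w ≠ 0 ∧ (v / w) ^ ((q - 1) * (r - 1)) = 1 := by
  obtain ⟨y, hyM, hy1, hy⟩ := exists_pow_eq_of_norm_sub_one_lt hM hr hr1 (M.pow_mem hvM _) hv1
  obtain ⟨w, hwM, hw1, hw⟩ := exists_pow_eq_of_norm_sub_one_lt hM hq hq1 hyM hy1
  refine ⟨w, hwM, ?_, ?_⟩
  · rintro rfl
    simp at hw1
  · rw [div_pow, pow_mul, pow_mul, hw, hy]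
    exact div_self (pow_ne_zero _ (pow_ne_zero _ hv))

end IsUltrametricDist

/-! ### Zeros of Eisenstein power series -/

namespace IsUltrametricDist

/-- The power series `∑ a i X ^ i` has no constant term, linear coefficient `ϖ`, coefficients
divisible by `ϖ` below the index `q`, and a unit as coefficient of index `q`. -/
structure IsEisensteinSeries {E : Type*} [NormedField E] (a : ℕ → E) (ϖ : E) (q : ℕ) : Prop where
  ne_zero : ϖ ≠ 0
  norm_lt_one : ‖ϖ‖ < 1
  two_le : 2 ≤ q
  norm_natCast_lt_one : ‖(q : E)‖ < 1
  coeff_zero : a 0 = 0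
  coeff_one : a 1 = ϖ
  norm_coeff_of_lt : ∀ i < q, ‖a i‖ ≤ ‖ϖ‖
  norm_coeff_eq_one : ‖a q‖ = 1
  norm_coeff_le_one : ∀ i, ‖a i‖ ≤ 1

namespace IsEisensteinSeries

variable {E : Type*} [NormedField E] {a : ℕ → E} {ϖ : E} {q : ℕ}

theorem coeff_ne_zero (h : IsEisensteinSeries a ϖ q) : a q ≠ 0 :=
  norm_ne_zero_iff.1 (h.norm_coeff_eq_one.trans_ne one_ne_zero)

variable {t : E}

theorem norm_scale (h : IsEisensteinSeries a ϖ q) (ht : t ^ (q - 1) = -ϖ / a q) :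
    ‖t‖ ^ (q - 1) = ‖ϖ‖ := by
  rw [← norm_pow, ht, norm_div, norm_neg, h.norm_coeff_eq_one, div_one]

theorem scale_ne_zero (h : IsEisensteinSeries a ϖ q) (ht : t ^ (q - 1) = -ϖ / a q) : t ≠ 0 := by
  rintro rfl
  have hq := h.two_le
  rw [zero_pow (by omega)] at ht
  exact div_ne_zero (neg_ne_zero.2 h.ne_zero) h.coeff_ne_zero ht.symm

theorem norm_scale_lt_one (h : IsEisensteinSeries a ϖ q) (ht : t ^ (q - 1) = -ϖ / a q) :
    ‖t‖ < 1 := by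
  by_contra! H
  exact (one_le_pow₀ H).not_gt ((h.norm_scale ht).trans_lt h.norm_lt_one)

theorem summable_norm_scaled (h : IsEisensteinSeries a ϖ q) (ht : t ^ (q - 1) = -ϖ / a q) :
    Summable fun i => ‖a i * t ^ i / (ϖ * t)‖ := by
  refine ((summable_geometric_of_lt_one (norm_nonneg _) (h.norm_scale_lt_one ht)).div_const
    ‖ϖ * t‖).of_nonneg_of_le (fun _ => norm_nonneg _) fun i => ?_
  rw [norm_div, norm_mul, norm_pow]
  gcongr
  exact mul_le_of_le_one_left (by positivity) (h.norm_coeff_le_one i)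

theorem hasSum_scaled_iff (h : IsEisensteinSeries a ϖ q) (ht : t ^ (q - 1) = -ϖ / a q) (z : E) :
    HasSum (fun i => a i * t ^ i / (ϖ * t) * z ^ i) 0 ↔
      HasSum (fun i => a i * (t * z) ^ i) 0 := by
  have h0 : ϖ * t ≠ 0 := mul_ne_zero h.ne_zero (h.scale_ne_zero ht)
  rw [← hasSum_mul_left_iff h0, mul_zero]
  refine iff_of_eq (congrArg (HasSum · 0) (funext fun i => ?_))
  rw [← mul_assoc, mul_div_cancel₀ _ h0, mul_pow, mul_assoc]

theorem hasSum_scaled_div (h : IsEisensteinSeries a ϖ q) (ht : t ^ (q - 1) = -ϖ / a q) {x : E}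
    (hx : HasSum (fun i => a i * x ^ i) 0) :
    HasSum (fun i => a i * t ^ i / (ϖ * t) * (x / t) ^ i) 0 := by
  rw [h.hasSum_scaled_iff ht, mul_div_cancel₀ _ (h.scale_ne_zero ht)]
  exact hx

variable {M : Subfield E}

theorem scaled_mem (h : IsEisensteinSeries a ϖ q) (haM : ∀ i, a i ∈ M) (htM : t ∈ M) (i : ℕ) :
    a i * t ^ i / (ϖ * t) ∈ M :=
  M.div_mem (M.mul_mem (haM i) (M.pow_mem htM i)) (M.mul_mem (h.coeff_one ▸ haM 1) htM)

/-- The choice of `t` makes the coefficient at `q` exactly `-1`. For `1 < i < q` the factor `ϖ` of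
`a i` cancels the denominator's and a power of `t` remains; for `i > q` use `‖t‖ ^ q = ‖ϖ * t‖`. -/
theorem isNearXSubXPow (h : IsEisensteinSeries a ϖ q) (ht : t ^ (q - 1) = -ϖ / a q) :
    IsNearXSubXPow (fun i => a i * t ^ i / (ϖ * t)) q (max ‖t‖ ‖(q : E)‖) := by
  have hq := h.two_le
  have ht0 := h.scale_ne_zero ht
  have htp : 0 < ‖t‖ := norm_pos_iff.2 ht0
  have ht1 := h.norm_scale_lt_one ht
  have hϖ : 0 < ‖ϖ‖ := norm_pos_iff.2 h.ne_zero
  have hϖ0 := h.ne_zero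
  have haq := h.coeff_ne_zero
  have htq : t ^ q = -ϖ / a q * t := by
    rw [← ht, ← pow_succ, Nat.sub_add_cancel (by omega)]
  have htq' : ‖t‖ ^ q = ‖ϖ‖ * ‖t‖ := by
    rw [← norm_pow, htq, norm_mul, norm_div, norm_neg, h.norm_coeff_eq_one, div_one]
  refine ⟨max_lt ht1 h.norm_natCast_lt_one, hq, le_max_right _ _, ?_, ?_, fun i hi hiq => ?_⟩
  · rw [h.coeff_one, pow_one, div_self (mul_ne_zero h.ne_zero ht0)]
  · rw [htq, show a q * (-ϖ / a q * t) / (ϖ * t) = -1 by field_simp, neg_add_cancel, norm_zero]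
    exact le_max_of_le_left htp.le
  · refine le_max_of_le_left ?_
    rw [norm_div, norm_mul, norm_mul, norm_pow, div_le_iff₀ (by positivity)]
    rcases lt_or_gt_of_ne hiq with hlt | hgt
    · rcases i with _ | _ | i
      · rw [h.coeff_zero, norm_zero, zero_mul]
        positivity
      · exact absurd rfl hi
      · calc ‖a (i + 1 + 1)‖ * ‖t‖ ^ (i + 1 + 1)
            ≤ ‖ϖ‖ * ‖t‖ ^ 2 := mul_le_mul (h.norm_coeff_of_lt _ hlt)
              (pow_le_pow_of_le_one htp.le ht1.le (by omega)) (by positivity) hϖ.le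
          _ = ‖t‖ * (‖ϖ‖ * ‖t‖) := by ring
    · calc ‖a i‖ * ‖t‖ ^ i ≤ 1 * ‖t‖ ^ (q + 1) := mul_le_mul (h.norm_coeff_le_one i)
            (pow_le_pow_of_le_one htp.le ht1.le (by omega)) (by positivity) zero_le_one
        _ = ‖t‖ * (‖ϖ‖ * ‖t‖) := by rw [← htq']; ring

variable [IsUltrametricDist E]

/-- A Newton polygon argument: the terms of index `1` and `q` dominate all others by a factor
`‖x‖⁻¹`, so they must have equal norm in order to cancel. -/
theorem norm_pow_eq_of_hasSum_zero (h : IsEisensteinSeries a ϖ q) {x : E} (hx0 : x ≠ 0)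
    (hx1 : ‖x‖ < 1) (hx : HasSum (fun i => a i * x ^ i) 0) : ‖x‖ ^ (q - 1) = ‖ϖ‖ := by
  have hq := h.two_le
  have hxp : 0 < ‖x‖ := norm_pos_iff.2 hx0
  have hϖ : 0 < ‖ϖ‖ := norm_pos_iff.2 h.ne_zero
  set C := max ‖ϖ * x‖ ‖a q * x ^ q‖ with hC
  have hCpos : 0 < C := lt_max_of_lt_left (norm_pos_iff.2 (mul_ne_zero h.ne_zero hx0))
  have hle : ‖ϖ * x + a q * x ^ q‖ ≤ ‖x‖ * C := by
    have h1 := ((hasSum_ite_eq 1 (ϖ * x)).add (hasSum_ite_eq q (a q * x ^ q))).sub hx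
    rw [sub_zero] at h1
    refine norm_le_of_hasSum h1 (by positivity) fun i => ?_
    rcases lt_trichotomy i q with hi | rfl | hi
    · rcases i with _ | _ | i
      · have : ¬ (0 = q) := by omega
        simp only [this, h.coeff_zero]
        simpa using by positivity
      · have : ¬ (0 + 1 = q) := by omega
        simp only [this, if_false, zero_add, h.coeff_one]
        simpa using by positivity
      · have h2 : ¬ (i + 1 + 1 = q) := by omega
        have h3 : ¬ (i + 1 + 1 = 1) := by omega
        rw [if_neg h2, if_neg h3, zero_add, zero_sub, norm_neg, norm_mul, norm_pow]
        calc ‖a (i + 1 + 1)‖ * ‖x‖ ^ (i + 1 + 1)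
            ≤ ‖ϖ‖ * ‖x‖ ^ 2 := mul_le_mul (h.norm_coeff_of_lt _ hi)
              (pow_le_pow_of_le_one hxp.le hx1.le (by omega)) (by positivity) hϖ.le
          _ = ‖x‖ * ‖ϖ * x‖ := by rw [norm_mul]; ring
          _ ≤ ‖x‖ * C := by gcongr; exact le_max_left _ _
    · have : ¬ (i = 1) := by omega
      simp only [this, if_false, if_true, zero_add, sub_self, norm_zero]
      positivity
    · have h2 : ¬ (i = q) := by omega
      have h3 : ¬ (i = 1) := by omega
      rw [if_neg h2, if_neg h3, zero_add, zero_sub, norm_neg, norm_mul, norm_pow]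
      calc ‖a i‖ * ‖x‖ ^ i ≤ 1 * ‖x‖ ^ (q + 1) := mul_le_mul (h.norm_coeff_le_one i)
              (pow_le_pow_of_le_one hxp.le hx1.le (by omega)) (by positivity) zero_le_one
        _ = ‖x‖ * ‖a q * x ^ q‖ := by rw [norm_mul, norm_pow, h.norm_coeff_eq_one]; ring
        _ ≤ ‖x‖ * C := by gcongr; exact le_max_right _ _
  have heq : ‖ϖ * x‖ = ‖a q * x ^ q‖ := by
    by_contra hne
    rw [norm_add_eq_max_of_norm_ne_norm hne, ← hC] at hle
    nlinarith
  rw [norm_mul, norm_mul, norm_pow, h.norm_coeff_eq_one, one_mul,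
    ← Nat.sub_add_cancel (show 1 ≤ q by omega), pow_succ] at heq
  exact (mul_right_cancel₀ hxp.ne' heq).symm

theorem norm_div_scale (h : IsEisensteinSeries a ϖ q) (ht : t ^ (q - 1) = -ϖ / a q) {x : E}
    (hx0 : x ≠ 0) (hx1 : ‖x‖ < 1) (hx : HasSum (fun i => a i * x ^ i) 0) : ‖x / t‖ = 1 := by
  have hq := h.two_le
  rw [norm_div, div_eq_one_iff_eq (norm_ne_zero_iff.2 (h.scale_ne_zero ht))]
  refine (pow_left_inj₀ (norm_nonneg _) (norm_nonneg _) (show q - 1 ≠ 0 by omega)).1 ?_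
  rw [h.norm_pow_eq_of_hasSum_zero hx0 hx1 hx, h.norm_scale ht]

theorem exists_ne_zero_hasSum_zero (h : IsEisensteinSeries a ϖ q) (hM : IsComplete (M : Set E))
    (haM : ∀ i, a i ∈ M) (ht : t ^ (q - 1) = -ϖ / a q) (htM : t ∈ M) :
    ∃ x ≠ 0, ‖x‖ < 1 ∧ HasSum (fun i => a i * x ^ i) 0 := by
  have hN := h.isNearXSubXPow ht
  obtain ⟨z, -, hz, hz0⟩ := hN.exists_hasSum_zero hM (h.scaled_mem haM htM)
    (h.summable_norm_scaled ht) M.one_mem (one_pow _)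
  have hz1 := hz.trans_lt hN.lt_one
  have hz2 : ‖z‖ ≤ 1 := by
    rw [← sub_add_cancel z 1]
    exact (norm_add_le_max _ _).trans (max_le hz1.le norm_one.le)
  refine ⟨t * z, mul_ne_zero (h.scale_ne_zero ht) ?_, ?_, (h.hasSum_scaled_iff ht z).1 hz0⟩
  · rintro rfl
    simp at hz1
  · rw [norm_mul]
    exact (mul_le_of_le_one_right (norm_nonneg _) hz2).trans_lt (h.norm_scale_lt_one ht)

theorem mem_of_hasSum_zero [IsAlgClosed E] (h : IsEisensteinSeries a ϖ q)
    (hM : IsComplete (M : Set E)) (haM : ∀ i, a i ∈ M) (hμ : ∀ ζ : E, ζ ^ (q - 1) = 1 → ζ ∈ M)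
    (ht : t ^ (q - 1) = -ϖ / a q) (htM : t ∈ M) {x : E} (hx1 : ‖x‖ < 1)
    (hx : HasSum (fun i => a i * x ^ i) 0) : x ∈ M := by
  by_cases hx0 : x = 0
  · exact hx0 ▸ M.zero_mem
  have := (h.isNearXSubXPow ht).mem_of_hasSum_zero hM (h.scaled_mem haM htM)
    (h.summable_norm_scaled ht) hμ (h.norm_div_scale ht hx0 hx1 hx) (h.hasSum_scaled_div ht hx)
  rw [← mul_div_cancel₀ x (h.scale_ne_zero ht)]
  exact mul_div_assoc t x t ▸ M.mul_mem htM this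

/-- Although `x / t` is not yet known to lie in `M`, its `(q - 1)`-th power does and is close to
`1`. A root of that power in `M` differs from `x / t` by a root of unity of `M`. -/
theorem scale_mem_of_hasSum_zero (h : IsEisensteinSeries a ϖ q) (hM : IsComplete (M : Set E))
    (haM : ∀ i, a i ∈ M) (hμ : ∀ ζ : E, ζ ^ (q - 1) = 1 → ζ ∈ M)
    (ht : t ^ (q - 1) = -ϖ / a q) {x : E} (hx0 : x ≠ 0) (hx1 : ‖x‖ < 1)
    (hx : HasSum (fun i => a i * x ^ i) 0) (hxM : x ∈ M) : t ∈ M := by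
  have hN := h.isNearXSubXPow ht
  have ht0 := h.scale_ne_zero ht
  have hc := (hN.norm_pow_sub_one_le (h.norm_div_scale ht hx0 hx1 hx)
    (h.hasSum_scaled_div ht hx)).trans_lt hN.lt_one
  have hcM : (x / t) ^ (q - 1) ∈ M := by
    rw [div_pow, ht]
    exact M.div_mem (M.pow_mem hxM _) (M.div_mem (M.neg_mem (h.coeff_one ▸ haM 1)) (haM q))
  obtain ⟨y, hyM, -, hy⟩ := exists_pow_eq_of_norm_sub_one_lt hM h.two_le h.norm_natCast_lt_one
    hcM hc
  have hζ : y / (x / t) ∈ M := hμ _ (by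
    rw [div_pow, hy, div_self (pow_ne_zero _ (div_ne_zero hx0 ht0))])
  have hy0 : y ≠ 0 := by
    rintro rfl
    have hq := h.two_le
    rw [zero_pow (by omega)] at hy
    exact pow_ne_zero _ (div_ne_zero hx0 ht0) hy.symm
  rw [show t = x * (y / (x / t)) / y by field_simp]
  exact M.div_mem (M.mul_mem hxM hζ) hyM

end IsEisensteinSeries

end IsUltrametricDist

/-! ### Finite extensions of `ℚ_p` -/

namespace FormalDivision

open IntermediateField

variable {p : ℕ} [Fact p.Prime]

theorem isComplete_of_finiteDimensional (L : IntermediateField ℚ_[p] (PadicAlgCl p))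
    [FiniteDimensional ℚ_[p] L] : IsComplete (L.toSubfield : Set (PadicAlgCl p)) :=
  Submodule.complete_of_finiteDimensional L.toSubalgebra.toSubmodule

theorem isComplete_adjoin (L : IntermediateField ℚ_[p] (PadicAlgCl p))
    [FiniteDimensional ℚ_[p] L] {S : Set (PadicAlgCl p)} (hS : S.Finite) :
    IsComplete ((adjoin L S).toSubfield : Set (PadicAlgCl p)) := by
  have := hS.to_subtype
  have : FiniteDimensional L (adjoin L S) := finiteDimensional_adjoin fun x _ =>
    (Algebra.IsIntegral.isIntegral (R := ℚ_[p]) x).tower_top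
  have : FiniteDimensional ℚ_[p] ((adjoin L S).restrictScalars ℚ_[p]) :=
    FiniteDimensional.trans ℚ_[p] L (adjoin L S)
  exact isComplete_of_finiteDimensional ((adjoin L S).restrictScalars ℚ_[p])

theorem norm_natCast_prime_pow_lt_one {k : ℕ} (hk : k ≠ 0) :
    ‖((p ^ k : ℕ) : PadicAlgCl p)‖ < 1 := by
  rw [← map_natCast (algebraMap ℚ_[p] (PadicAlgCl p)), PadicAlgCl.norm_extends, Nat.cast_pow,
    norm_pow]
  exact pow_lt_one₀ (norm_nonneg _) Padic.norm_p_lt_one hk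

section ResidueField

variable (K : IntermediateField ℚ_[p] (PadicAlgCl p))

variable {K} in
theorem mem_maximalIdeal_iff (x : ringOfIntegers K) :
    x ∈ IsLocalRing.maximalIdeal (ringOfIntegers K) ↔ ‖((x : K) : PadicAlgCl p)‖ < 1 := by
  rw [IsLocalRing.mem_maximalIdeal, mem_nonunits_iff, ← not_iff_not, not_not, not_lt]
  constructor
  · intro hx
    obtain ⟨y, hy⟩ := hx.exists_right_inv
    have h := congrArg (fun z : ringOfIntegers K => ‖((z : K) : PadicAlgCl p)‖) hy
    have hy' : ‖((y : K) : PadicAlgCl p)‖ ≤ 1 := y.2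
    simp only [MulMemClass.coe_mul, norm_mul, OneMemClass.coe_one, norm_one] at h
    nlinarith [norm_nonneg ((x : K) : PadicAlgCl p)]
  · intro hx
    have hx0 : (x : K) ≠ 0 := by
      intro h0
      rw [h0, ZeroMemClass.coe_zero, norm_zero] at hx
      exact zero_lt_one.not_ge hx
    refine IsUnit.of_mul_eq_one ⟨(x : K)⁻¹, (mem_ringOfIntegers _).2 ?_⟩
      (Subtype.ext (mul_inv_cancel₀ hx0))
    change ‖((x : K) : PadicAlgCl p)⁻¹‖ ≤ 1
    rw [norm_inv]
    exact inv_le_one_of_one_le₀ hx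

/-- Together with openness of the maximal ideal this makes the residue field finite. -/
theorem compactSpace_ringOfIntegers [FiniteDimensional ℚ_[p] K] :
    CompactSpace (ringOfIntegers K) := by
  let V := K.toSubalgebra.toSubmodule
  have : FiniteDimensional ℚ_[p] V := ‹FiniteDimensional ℚ_[p] K›
  have : ProperSpace V := FiniteDimensional.proper ℚ_[p] V
  have hV : IsCompact ((V : Set (PadicAlgCl p)) ∩ Metric.closedBall 0 1) := by
    have h := (isCompact_closedBall (0 : V) 1).image continuous_subtype_val
    convert! h using 1
    ext x
    simp only [Set.mem_inter_iff, SetLike.mem_coe, mem_closedBall_zero_iff, Set.mem_image,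
      Subtype.exists]
    exact ⟨fun hx => ⟨x, hx.1, hx.2, rfl⟩, fun ⟨y, hy, hy', hyx⟩ => hyx ▸ ⟨hy, hy'⟩⟩
  have hind : Topology.IsInducing fun x : ringOfIntegers K => ((x : K) : PadicAlgCl p) :=
    Topology.IsInducing.subtypeVal.comp Topology.IsInducing.subtypeVal
  rw [← isCompact_univ_iff, hind.isCompact_iff]
  convert! hV using 1
  ext x
  simp only [Set.image_univ, Set.mem_range, Set.mem_inter_iff, mem_closedBall_zero_iff]
  exact ⟨fun ⟨y, hy⟩ => hy ▸ ⟨(y : K).2, y.2⟩, fun hx => ⟨⟨⟨x, hx.1⟩, hx.2⟩, rfl⟩⟩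

theorem isOpen_maximalIdeal :
    IsOpen (IsLocalRing.maximalIdeal (ringOfIntegers K) : Set (ringOfIntegers K)) := by
  have hc : Continuous fun x : ringOfIntegers K => ((x : K) : PadicAlgCl p) :=
    continuous_subtype_val.comp continuous_subtype_val
  convert! (Metric.isOpen_ball (x := (0 : PadicAlgCl p)) (ε := 1)).preimage hc using 1
  ext x
  rw [SetLike.mem_coe, mem_maximalIdeal_iff, Set.mem_preimage, mem_ball_zero_iff]

instance [FiniteDimensional ℚ_[p] K] :
    Finite (IsLocalRing.ResidueField (ringOfIntegers K)) := by
  have := compactSpace_ringOfIntegers K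
  exact AddSubgroup.quotient_finite_of_isOpen
    (IsLocalRing.maximalIdeal (ringOfIntegers K)).toAddSubgroup (isOpen_maximalIdeal K)

theorem card_residueField [FiniteDimensional ℚ_[p] K] :
    Nat.card (IsLocalRing.ResidueField (ringOfIntegers K)) = p ^ residueDegree K := by
  have : Finite (IsLocalRing.ResidueField ℤ_[p]) :=
    Finite.of_equiv _ (PadicInt.residueField (p := p)).symm.toEquiv
  rw [Module.natCard_eq_pow_finrank (K := IsLocalRing.ResidueField ℤ_[p]), residueDegree,
    Nat.card_congr (PadicInt.residueField (p := p)).toEquiv, Nat.card_zmod]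

theorem residueDegree_ne_zero [FiniteDimensional ℚ_[p] K] : residueDegree K ≠ 0 := by
  intro h
  have := card_residueField K
  rw [h, pow_zero] at this
  exact (Finite.one_lt_card (α := IsLocalRing.ResidueField (ringOfIntegers K))).ne' this

theorem norm_pow_sub_one_lt [FiniteDimensional ℚ_[p] K] (u : PadicAlgCl p) (huK : u ∈ K)
    (hu : ‖u‖ = 1) : ‖u ^ (p ^ residueDegree K - 1) - 1‖ < 1 := by
  let v : ringOfIntegers K := ⟨⟨u, huK⟩, hu.le⟩
  have hv : IsLocalRing.residue (ringOfIntegers K) v ≠ 0 := by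
    rw [Ne, IsLocalRing.residue_eq_zero_iff, mem_maximalIdeal_iff]
    exact hu.not_lt
  have h1 : IsLocalRing.residue (ringOfIntegers K) (v ^ (p ^ residueDegree K - 1) - 1) = 0 := by
    rw [map_sub, map_pow, map_one, ← card_residueField, sub_eq_zero]
    have := Fintype.ofFinite (IsLocalRing.ResidueField (ringOfIntegers K))
    rw [Nat.card_eq_fintype_card]
    exact FiniteField.pow_card_sub_one_eq_one _ hv
  rw [IsLocalRing.residue_eq_zero_iff, mem_maximalIdeal_iff] at h1
  exact h1

end ResidueField

theorem le_adjoinRootsOfUnity (K : IntermediateField ℚ_[p] (PadicAlgCl p)) (m : ℕ) :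
    K ≤ adjoinRootsOfUnity K m := fun x hx =>
  (adjoin K {ζ : PadicAlgCl p | ζ ^ m = 1}).algebraMap_mem ⟨x, hx⟩

theorem mem_adjoinRootsOfUnity_of_pow_eq_one (K : IntermediateField ℚ_[p] (PadicAlgCl p))
    {m : ℕ} {ζ : PadicAlgCl p} (hζ : ζ ^ m = 1) : ζ ∈ adjoinRootsOfUnity K m :=
  subset_adjoin K {ζ : PadicAlgCl p | ζ ^ m = 1} hζ

theorem finiteDimensional_adjoinRootsOfUnity (K : IntermediateField ℚ_[p] (PadicAlgCl p))
    [FiniteDimensional ℚ_[p] K] {m : ℕ} (hm : m ≠ 0) :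
    FiniteDimensional ℚ_[p] (adjoinRootsOfUnity K m) := by
  have : Finite {ζ : PadicAlgCl p | ζ ^ m = 1} := by
    refine Set.Finite.to_subtype ((Polynomial.nthRootsFinset m (1 : PadicAlgCl p)).finite_toSet.subset
      fun ζ hζ => ?_)
    exact (Polynomial.mem_nthRootsFinset (Nat.pos_of_ne_zero hm) _).2 hζ
  have : FiniteDimensional K (adjoin K {ζ : PadicAlgCl p | ζ ^ m = 1}) :=
    finiteDimensional_adjoin fun x _ =>
      (Algebra.IsIntegral.isIntegral (R := ℚ_[p]) x).tower_top
  exact FiniteDimensional.trans ℚ_[p] K (adjoin K {ζ : PadicAlgCl p | ζ ^ m = 1})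

/-- A `(q - 1)`-th root of a unit of `K` lies in any field containing `K` and the roots of unity of
order `(q - 1) (p ^ f - 1)`, for a power `q` of `p`. -/
theorem mem_adjoinRootsOfUnity_of_pow_mem (K : IntermediateField ℚ_[p] (PadicAlgCl p))
    [FiniteDimensional ℚ_[p] K] {h : ℕ} (hh : h ≠ 0) {v : PadicAlgCl p}
    (hvK : v ^ (p ^ h - 1) ∈ K) (hv : ‖v‖ = 1) :
    v ∈ adjoinRootsOfUnity K ((p ^ h - 1) * (p ^ residueDegree K - 1)) := by
  have hp2 := (Fact.out : p.Prime).two_le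
  have hf := residueDegree_ne_zero K
  have hK := isComplete_of_finiteDimensional K
  have h1 := norm_pow_sub_one_lt K _ hvK (by rw [norm_pow, hv, one_pow])
  obtain ⟨w, hwK, hw0, hζ⟩ := IsUltrametricDist.exists_div_pow_eq_one hK
    (hp2.trans (Nat.le_self_pow hh p)) (norm_natCast_prime_pow_lt_one hh)
    (hp2.trans (Nat.le_self_pow hf p)) (norm_natCast_prime_pow_lt_one hf)
    (norm_ne_zero_iff.1 (hv.trans_ne one_ne_zero)) hvK h1
  rw [← div_mul_cancel₀ v hw0]
  exact mul_mem (mem_adjoinRootsOfUnity_of_pow_eq_one K hζ) (le_adjoinRootsOfUnity K _ hwK)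

/-! ### Torsion of unramified group laws -/

namespace UnramifiedGroupLaw

variable {K : IntermediateField ℚ_[p] (PadicAlgCl p)} {π : ringOfIntegers K}

theorem piCoeff_mem (F : UnramifiedGroupLaw π) (i : ℕ) : F.piCoeff i ∈ K :=
  Subtype.property _

theorem norm_piCoeff_le_one (F : UnramifiedGroupLaw π) (i : ℕ) : ‖F.piCoeff i‖ ≤ 1 :=
  (PowerSeries.coeff i (F.bracket (generatedField.gen π))).2

theorem norm_le_of_norm_lt_one
    (hπ : Ideal.span {π} = IsLocalRing.maximalIdeal (ringOfIntegers K)) {x : ringOfIntegers K}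
    (hx : ‖((x : K) : PadicAlgCl p)‖ < 1) :
    ‖((x : K) : PadicAlgCl p)‖ ≤ ‖((π : K) : PadicAlgCl p)‖ := by
  rw [← mem_maximalIdeal_iff, ← hπ, Ideal.mem_span_singleton] at hx
  obtain ⟨y, rfl⟩ := hx
  have hy : ‖((y : K) : PadicAlgCl p)‖ ≤ 1 := y.2
  simp only [MulMemClass.coe_mul, norm_mul]
  exact mul_le_of_le_one_right (norm_nonneg _) hy

theorem isEisensteinSeries_piCoeff (F : UnramifiedGroupLaw π)
    (hπ : Ideal.span {π} = IsLocalRing.maximalIdeal (ringOfIntegers K)) {h : ℕ}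
    (hF : F.HasHeight h) :
    IsUltrametricDist.IsEisensteinSeries F.piCoeff ((π : K) : PadicAlgCl p) (p ^ h) := by
  have hp2 := (Fact.out : p.Prime).two_le
  have hh : h ≠ 0 := hF.1.ne'
  have hπ1 : ‖((π : K) : PadicAlgCl p)‖ < 1 :=
    (mem_maximalIdeal_iff π).1 (hπ ▸ Ideal.mem_span_singleton_self π)
  have h1 : F.piCoeff 1 = ((π : K) : PadicAlgCl p) := by
    rw [piCoeff, F.coeff_one_bracket]
    rfl
  have h0 : F.piCoeff 0 = 0 := by
    rw [piCoeff, PowerSeries.coeff_zero_eq_constantCoeff_apply, F.constantCoeff_bracket]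
    rfl
  refine ⟨?_, hπ1, hp2.trans (Nat.le_self_pow hh p), norm_natCast_prime_pow_lt_one hh, h0, h1,
    fun i hi => ?_, hF.2.1.2, F.norm_piCoeff_le_one⟩
  -- `π ≠ 0` because it divides `p`.
  · have hp := norm_le_of_norm_lt_one hπ (x := algebraMap ℤ_[p] (ringOfIntegers K) p)
    simp only [norm_algebraMap_padicInt, PadicInt.norm_p] at hp
    refine norm_pos_iff.1 (lt_of_lt_of_le ?_ (hp (inv_lt_one_of_one_lt₀ ?_)))
    · exact inv_pos.2 (by exact_mod_cast (Fact.out : p.Prime).pos)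
    · exact_mod_cast (Fact.out : p.Prime).one_lt
  · rcases i with _ | _ | i
    · rw [h0, norm_zero]
      exact norm_nonneg _
    · exact (congrArg norm h1).le
    · refine norm_le_of_norm_lt_one hπ (lt_of_le_of_ne (F.norm_piCoeff_le_one _) fun h => ?_)
      exact hi.not_ge (hF.2.2 ⟨by omega, h⟩)

theorem adjoin_piTorsion_eq (F : UnramifiedGroupLaw π)
    (hπ : Ideal.span {π} = IsLocalRing.maximalIdeal (ringOfIntegers K)) {h : ℕ}
    (hF : F.HasHeight h) (L : IntermediateField ℚ_[p] (PadicAlgCl p)) [FiniteDimensional ℚ_[p] L]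
    (hKL : K ≤ L) (hμ : ∀ ζ : PadicAlgCl p, ζ ^ (p ^ h - 1) = 1 → ζ ∈ L) {t : PadicAlgCl p}
    (ht : t ^ (p ^ h - 1) = -((π : K) : PadicAlgCl p) / F.piCoeff (p ^ h)) :
    adjoin L F.piTorsion = adjoin L {t} := by
  have hE := F.isEisensteinSeries_piCoeff hπ hF
  have hL : ∀ (S : Set (PadicAlgCl p)), ∀ x ∈ L, x ∈ (adjoin L S).toSubfield := fun S x hx =>
    (adjoin L S).algebraMap_mem ⟨x, hx⟩
  have hc := isComplete_adjoin L (Set.finite_singleton t)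
  have ht' : t ∈ (adjoin L {t}).toSubfield := mem_adjoin_simple_self L t
  refine le_antisymm (adjoin_le_iff.2 fun x hx => ?_) (adjoin_simple_le_iff.2 ?_)
  · exact hE.mem_of_hasSum_zero hc (fun i => hL _ _ (hKL (F.piCoeff_mem i)))
      (fun ζ hζ => hL _ _ (hμ ζ hζ)) ht ht' hx.1 hx.2
  · obtain ⟨x, hx0, hx1, hx⟩ := hE.exists_ne_zero_hasSum_zero hc
      (fun i => hL _ _ (hKL (F.piCoeff_mem i))) ht ht'
    -- A single nonzero torsion point suffices, and `L(x)` is complete without knowing that the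
    -- torsion is finite.
    have := hE.scale_mem_of_hasSum_zero (isComplete_adjoin L (Set.finite_singleton x))
      (fun i => hL _ _ (hKL (F.piCoeff_mem i))) (fun ζ hζ => hL _ _ (hμ ζ hζ)) ht hx0 hx1 hx
      (mem_adjoin_simple_self L x)
    have hxF : x ∈ F.piTorsion := ⟨hx1, hx⟩
    exact adjoin.mono L _ _ (Set.singleton_subset_iff.2 hxF) this

theorem adjoin_piTorsion_eq_adjoin_piTorsion [FiniteDimensional ℚ_[p] K] {π' : ringOfIntegers K}
    (F : UnramifiedGroupLaw π) (F' : UnramifiedGroupLaw π')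
    (hπ : Ideal.span {π} = IsLocalRing.maximalIdeal (ringOfIntegers K))
    (hπ' : Ideal.span {π'} = IsLocalRing.maximalIdeal (ringOfIntegers K)) {h : ℕ}
    (hF : F.HasHeight h) (hF' : F'.HasHeight h) {L : IntermediateField ℚ_[p] (PadicAlgCl p)}
    (hL : L = adjoinRootsOfUnity K ((p ^ h - 1) * (p ^ residueDegree K - 1))) :
    adjoin L F.piTorsion = adjoin L F'.piTorsion := by
  have hh : h ≠ 0 := hF.1.ne'
  have hE := F.isEisensteinSeries_piCoeff hπ hF
  have hE' := F'.isEisensteinSeries_piCoeff hπ' hF'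
  have hq1 : p ^ h - 1 ≠ 0 := by have := hE.two_le; omega
  have hf1 : p ^ residueDegree K - 1 ≠ 0 := by
    have := Nat.one_lt_pow (residueDegree_ne_zero K) (Fact.out : p.Prime).one_lt
    omega
  have hfin : FiniteDimensional ℚ_[p] L :=
    hL ▸ finiteDimensional_adjoinRootsOfUnity K (mul_ne_zero hq1 hf1)
  have hKL : K ≤ L := hL ▸ le_adjoinRootsOfUnity K _
  have hμ : ∀ ζ : PadicAlgCl p, ζ ^ (p ^ h - 1) = 1 → ζ ∈ L := fun ζ hζ =>
    hL ▸ mem_adjoinRootsOfUnity_of_pow_eq_one K (by rw [pow_mul, hζ, one_pow])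
  obtain ⟨t, ht⟩ := IsAlgClosed.exists_pow_nat_eq
    (-((π : K) : PadicAlgCl p) / F.piCoeff (p ^ h)) (Nat.pos_of_ne_zero hq1)
  obtain ⟨t', ht'⟩ := IsAlgClosed.exists_pow_nat_eq
    (-((π' : K) : PadicAlgCl p) / F'.piCoeff (p ^ h)) (Nat.pos_of_ne_zero hq1)
  have ht0 := hE.scale_ne_zero ht
  have ht0' := hE'.scale_ne_zero ht'
  have hnorm : ‖((π : K) : PadicAlgCl p)‖ = ‖((π' : K) : PadicAlgCl p)‖ := le_antisymm
    (norm_le_of_norm_lt_one hπ' hE.norm_lt_one) (norm_le_of_norm_lt_one hπ hE'.norm_lt_one)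
  have hnt : ‖t / t'‖ = 1 := by
    rw [norm_div, div_eq_one_iff_eq (norm_ne_zero_iff.2 ht0')]
    refine (pow_left_inj₀ (norm_nonneg _) (norm_nonneg _) hq1).1 ?_
    rw [hE.norm_scale ht, hE'.norm_scale ht', hnorm]
  have hmem : t / t' ∈ L := by
    rw [hL]
    refine mem_adjoinRootsOfUnity_of_pow_mem K hh ?_ hnt
    rw [div_pow, ht, ht']
    exact div_mem (div_mem (neg_mem (π : K).2) (F.piCoeff_mem _))
      (div_mem (neg_mem (π' : K).2) (F'.piCoeff_mem _))
  rw [F.adjoin_piTorsion_eq hπ hF L hKL hμ ht, F'.adjoin_piTorsion_eq hπ' hF' L hKL hμ ht']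
  have hmem' : ∀ S : Set (PadicAlgCl p), t / t' ∈ adjoin L S := fun S =>
    (adjoin L S).algebraMap_mem ⟨_, hmem⟩
  refine le_antisymm (adjoin_simple_le_iff.2 ?_) (adjoin_simple_le_iff.2 ?_)
  · rw [← div_mul_cancel₀ t ht0']
    exact mul_mem (hmem' _) (mem_adjoin_simple_self L t')
  · rw [show t' = t / (t / t') by field_simp]
    exact div_mem (mem_adjoin_simple_self L t) (hmem' _)

end UnramifiedGroupLaw

end FormalDivision

open FormalDivision in
theorem theorem1p1 (p : ℕ) [Fact p.Prime] (hp : p ≠ 2)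
    (K : IntermediateField ℚ_[p] (PadicAlgCl p)) [FiniteDimensional ℚ_[p] K]
    (n : ℕ) (hn : 2 ≤ n) (h : ℕ) (hh : h ∣ residueDegree K)
    (π : Fin n → ringOfIntegers K)
    (hπ : ∀ i, Ideal.span {π i} = IsLocalRing.maximalIdeal (ringOfIntegers K))
    (F : ∀ i, UnramifiedGroupLaw (π i))
    (hF : ∀ i, UnramifiedGroupLaw.HasHeight (F i) h)
    (K₁ : IntermediateField ℚ_[p] (PadicAlgCl p))
    (hK₁ : K₁ = adjoinRootsOfUnity K ((p ^ h - 1) * (p ^ residueDegree K - 1))) :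
    (∀ i j, IntermediateField.adjoin K₁ (UnramifiedGroupLaw.piTorsion (F i)) =
        IntermediateField.adjoin K₁ (UnramifiedGroupLaw.piTorsion (F j))) ∧
      ∀ i, IntermediateField.adjoin K₁ (UnramifiedGroupLaw.piTorsion (F i)) =
        IntermediateField.adjoin K₁ (⋃ j, UnramifiedGroupLaw.piTorsion (F j)) := by
  have key : ∀ i j, IntermediateField.adjoin K₁ (UnramifiedGroupLaw.piTorsion (F i)) =
      IntermediateField.adjoin K₁ (UnramifiedGroupLaw.piTorsion (F j)) := fun i j =>
    (F i).adjoin_piTorsion_eq_adjoin_piTorsion (F j) (hπ i) (hπ j) (hF i) (hF j) hK₁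
  refine ⟨key, fun i => le_antisymm
    (IntermediateField.adjoin.mono _ _ _ (Set.subset_iUnion (fun j => (F j).piTorsion) i))
    (IntermediateField.adjoin_le_iff.2 (Set.iUnion_subset fun j => ?_))⟩
  rw [key i j]
  exact IntermediateField.subset_adjoin _ _
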